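/- **Setting.** Alice's gadget uses a CSS code of length $l$ with one logical qubit and logical operators $X_L=X^{\otimes l}$, $Z_L=Z^{\otimes l}$, $H_L=H^{\otimes l}$, and for each of the two bases a classical decoder that maps $l$ physical outcomes to a logical outcome (the parity, on code words). Fix $0<p<1/2$, $0<p'<1$. In one run of the gadget Alice tosses independent bits $c_i,a_i,r_i$ $(1\le i\le 5)$; $a_i,r_i$ are uniform, and $\Pr[c_1=1]=\Pr[c_5=1]=p/(1-p)$, $\Pr[c_2=1]=\Pr[c_4=1]=1-p$, $\Pr[c_3=1]=1-p'$. For $i=1,\dots,5$ Bob sends $l$ qubits (honestly: one half of a logical Bell pair); Alice measures all of them in the $Z$ basis if $c_i=0$ and in the $X$ basis if $c_i=1$, decodes a bit $o_i$, and requests from Bob the correction $X_L^{a_i\oplus o_i}Z_L^{r_i}$ if $c_i=0$ and $X_L^{r_i}Z_L^{a_i\oplus o_i}$ if $c_i=1$. Bob then reports bits $(s_1,s_2,s_4,s_5)$. If they are all $0$ the run is kept, and Alice records that the following state has been prepared: if $c_3=0$: $|a_3\rangle$; if $(c_2,c_3,c_4)=(0,1,0)$: $Z^{a_2+a_3+a_4}|+_0\rangle$;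 if $(c_2,c_3,c_4,c_5)=(0,1,1,0)$: $|a_4\oplus a_5\rangle$; if $(c_2,c_3,c_4,c_5)=(0,1,1,1)$: $Z^{a_2+a_3+a_4+a_5}|+_2\rangle$; if $(c_1,c_2,c_3)=(0,1,1)$: $|a_1\oplus a_2\rangle$; if $(c_1,c_2,c_3,c_4)=(1,1,1,0)$: $X^{a_2}Z^{a_1+a_3+a_4}|+_1\rangle$; if $c=(1,1,1,1,0)$: $|a_4\oplus a_5\rangle$; if $c=(1,1,1,1,1)$: $X^{a_2}Z^{a_1+a_2+a_3+a_4+a_5}|+_3\rangle$; where $|+_k\rangle=(|0\rangle+e^{ik\pi/4}|1\rangle)/\sqrt2$ (names of states up to global phase). Otherwise the run is discarded. In the protocol the gadget is repeated until at least $N_D$ of the kept runs have prepared $Z$-basis states and at least $N-N_D$ of them states $|+_k\rangle$, where $N_D/N=1-4p^2(1-p')$. By a rule that depends only on which runs were kept and which of these gave $Z$-basis states, Alice assigns distinct kept runs to the $N$ vertices of a graph, $Z$-basis states to a set $D$ of $N_D$ dummy vertices and states $|+_k\rangle$ to the others, and tells Bob the assignment. Then, as in the Fitzsimons–Kashefi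 (FK) protocol, for $v=1,\dots,N$ she sends $\delta_v=k'_v\pi/4+\phi_v+r'_v\pi+n_v\pi$ and Bob replies with a bit $b_v$. Here $r'_v$ is a uniform bit and $n_v$ is the number of neighbours of $v$ in the state $|1\rangle$; at dummy vertices $k'_v\in\{0,\dots,7\}$ and $\phi_v\in\{0,\pi/4,\dots,7\pi/4\}$ are uniform; at other vertices $|+_{k'_v}\rangle$ is the recorded state, $\phi_v=0$ at the trap vertices, and at the remaining vertices $\phi_v$ is prescribed by the delegated computation as a function of the corrected outcomes $b_u\oplus r'_u$, $u<v$. Bob may behave arbitrarily and adaptively throughout, acting on a finite-dimensional memory $b$ by arbitrary quantum operations on all that he has received so far. **Theorem 3.** The fault-tolerant protocol is blind, for every behaviour of Bob: 1. *(State preparation.)* For every $M$ and every sequence of reports of Bob in $M$ runs there is a trace-preserving completely positive map $\mathcal E_b$, which depends only on Bob's behaviour and on these reports (not on $p,p',N,N_D$), such that, whenever the reports have non-zero probability, the normalised joint output state $\rho_{ab}$ of Alice's register of recorded states of the kept runs and of Bob's system satisfies $$\mathrm{Tr}[\Pi_b\,\rho_{ab}]=\mathrm{Tr}[\Pi_b\,\rho_{ab}^{(\mathrm{FK})}]$$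 for every POVM element $\Pi_b$ on Bob's system. Here $\rho^{(\mathrm{FK})}_{ab}$ is the output of the state-preparation step of the FK protocol with deviation $\mathcal E_b$: with one qubit for each kept run, $$\rho^{(\mathrm{FK})}_{ab}=\mathcal E_b\Big(\bigotimes\Big[\sum_{z=0}^1\tfrac{N_D}{2N}|z\rangle\langle z|_a\otimes|z\rangle\langle z|_b+\sum_{k=0}^7\tfrac{N-N_D}{8N}|k\rangle\langle k|_a\otimes|+_k\rangle\langle +_k|_b\Big]\Big).$$ 2. *(Whole protocol.)* For fixed $N$, graph, $D$, $p$, $p'$ and assignment rule, Bob's statistics at the end of the protocol do not depend on what Alice delegates: for every $M$ and every POVM element $\Pi_b$, the probability that the state preparation takes exactly $M$ runs and $\Pi_b$ then occurs at the end is the same for any two choices of trap vertices and of the prescribed angles $\phi_v$. -/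

import Mathlib

open scoped Matrix Kronecker ComplexOrder

/-- Classical bits, added modulo two. -/
abbrev Bit : Type := ZMod 2

/-! ### Quantum operations on finite-dimensional systems -/

section Operations

variable {m n O : Type} [Fintype m] [DecidableEq m] [Fintype n] [DecidableEq n] [Fintype O]

/-- A quantum instrument with classical outcomes in `O`, in Kraus form. -/
structure Instrument (O m n : Type) [Fintype m] [DecidableEq m] [Fintype n] [DecidableEq n]
    [Fintype O] where
  /-- the number of Kraus operators per outcome -/
  rank : ℕ
  /-- the Kraus operators -/
  kraus : O → Fin rank → Matrix n m ℂ
  /-- the total operation is trace preserving -/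
  complete : ∑ o, ∑ j, (kraus o j)ᴴ * kraus o j = 1

/-- The (unnormalised) state after the outcome `o`. -/
def Instrument.apply (I : Instrument O m n) (o : O) (ρ : Matrix m m ℂ) : Matrix n n ℂ :=
  ∑ j, I.kraus o j * ρ * (I.kraus o j)ᴴ

/-- A TPCP map, in Kraus form. -/
abbrev Channel (m n : Type) [Fintype m] [DecidableEq m] [Fintype n] [DecidableEq n] : Type :=
  Instrument Unit m n

/-- The action of a TPCP map on a state. -/
def Channel.map (E : Channel m n) (ρ : Matrix m m ℂ) : Matrix n n ℂ :=
  Instrument.apply E () ρ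

/-- An element of a positive operator valued measure: `0 ≤ Π ≤ 1`. -/
def IsPOVMElement (Q : Matrix m m ℂ) : Prop :=
  Q.PosSemidef ∧ (1 - Q).PosSemidef

/-- A density matrix. -/
def IsDensity (ρ : Matrix m m ℂ) : Prop :=
  ρ.PosSemidef ∧ ρ.trace = 1

end Operations

/-! ### Single-qubit states -/

/-- The amplitudes of `H^c X^a |0⟩`: the `Z`-basis states for `c = 0`, the `X`-basis states for
`c = 1`. -/
noncomputable def basisKet (c a v : Bit) : ℂ :=
  if c = 0 then (if v = a then 1 else 0)
  else (1 / (Real.sqrt 2 : ℂ)) * (-1) ^ (a.val * v.val)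

/-- The amplitudes of `|+_k⟩ = (|0⟩ + e^{ikπ/4} |1⟩) / √2`. -/
noncomputable def plusKet (k : ZMod 8) (v : Bit) : ℂ :=
  (1 / (Real.sqrt 2 : ℂ)) *
    (if v = 0 then 1 else Complex.exp ((k.val : ℂ) * (Real.pi / 4 : ℝ) * Complex.I))

/-- Names of the ten states: `inl z` for `|z⟩`, and `inr k` for `|+_k⟩`. -/
abbrev Label : Type := Bit ⊕ ZMod 8

/-- The amplitudes of the state with a given name. -/
noncomputable def labelKet : Label → Bit → ℂ
  | Sum.inl z => basisKet 0 z
  | Sum.inr k => plusKet k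

/-! ### CSS codes -/

/-- A CSS code of length `l` with one logical qubit, for which `X^{⊗l}`, `Z^{⊗l}` and `H^{⊗l}` are
the logical `X`, `Z` and `H`: it is built on a classical code `C` which contains its dual
`C^⊥`, with `C = C^⊥ ∪ (1 + C^⊥)` and `1 ∉ C^⊥`; `|0_L⟩` and `|1_L⟩` are the uniform superpositions
over `C^⊥` and over `1 + C^⊥`. -/
structure CSSCode (l : ℕ) where
  /-- the classical code -/
  C : Submodule (ZMod 2) (Fin l → Bit)
  dual_le : ∀ v : Fin l → Bit, (∀ w ∈ C, v ⬝ᵥ w = 0) → v ∈ C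
  one_mem : (1 : Fin l → Bit) ∈ C
  one_notMem_dual : ∃ w ∈ C, (1 : Fin l → Bit) ⬝ᵥ w ≠ 0
  one_qubit : ∀ v ∈ C, (∀ w ∈ C, v ⬝ᵥ w = 0) ∨ (∀ w ∈ C, (v + 1) ⬝ᵥ w = 0)

/-- Classical post-processing of the `l` physical outcomes of a transversal `Z` (or `X`)
measurement: on the words of the classical code it returns the logical outcome, which is the
parity; on all other words it may do anything. -/
def CSSCode.IsDecoder {l : ℕ} (code : CSSCode l) (f : (Fin l → Bit) → Bit) : Prop :=
  ∀ w ∈ code.C, f w = ∑ j, w j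

/-! ### Alice in the gadget -/

/-- The coins `(c, a, r)` which Alice tosses for one run of the gadget. -/
abbrev Coins : Type := (Fin 5 → Bit) × (Fin 5 → Bit) × (Fin 5 → Bit)

/-- The probabilities of `c_1 = 1, …, c_5 = 1`. -/
noncomputable def basisProb (p p' : ℝ) : Fin 5 → ℝ :=
  ![p / (1 - p), 1 - p, 1 - p', 1 - p, p / (1 - p)]

/-- The probability of the coins of one run: the bits of `a` and `r` are uniform. -/
noncomputable def coinProb (p p' : ℝ) (x : Coins) : ℝ :=
  (∏ i, (if x.1 i = 1 then basisProb p p' i else 1 - basisProb p p' i)) *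
    (1 / 2 ^ 5) * (1 / 2 ^ 5)

/-- A bit as an integer modulo eight. -/
def bitToOct (b : Bit) : ZMod 8 := (b.val : ZMod 8)

/-- The name of the state `|B⟩` that a run of the gadget prepares when
`s_1 = s_2 = s_4 = s_5 = 0`. Indices start at zero. Up to a global phase, `Z |+_k⟩ = |+_{k+4}⟩`
and `X |+_k⟩ = |+_{-k}⟩`. -/
def preparedLabel (c a : Fin 5 → Bit) : Label :=
  if c 2 = 0 then Sum.inl (a 2)
  else if c 1 = 0 then
    if c 3 = 0 then Sum.inr (4 * bitToOct (a 1 + a 2 + a 3))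
    else if c 4 = 0 then Sum.inl (a 3 + a 4)
    else Sum.inr (2 + 4 * bitToOct (a 1 + a 2 + a 3 + a 4))
  else if c 0 = 0 then Sum.inl (a 0 + a 1)
  else if c 3 = 0 then
    Sum.inr ((if a 1 = 0 then 1 else -1) * (1 + 4 * bitToOct (a 0 + a 2 + a 3)))
  else if c 4 = 0 then Sum.inl (a 3 + a 4)
  else
    Sum.inr ((if a 1 = 0 then 1 else -1) *
      (3 + 4 * bitToOct (a 0 + a 1 + a 2 + a 3 + a 4)))

/-- The exponents of `X_L` and of `Z_L` in the correction which Alice requests from Bob, after the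
decoded outcome `o`. -/
def correction (c a r o : Bit) : Bit × Bit :=
  if c = 0 then (a + o, r) else (r, a + o)

/-- Alice measures the `l` qubits which Bob sent, all of them in the `Z` basis (`c = 0`) or all of
them in the `X` basis (`c = 1`), and obtains the outcomes `w`: Bob's unnormalised state. -/
noncomputable def measureQubits {l : ℕ} {B : Type} (c : Bit) (w : Fin l → Bit)
    (σ : Matrix (B × (Fin l → Bit)) (B × (Fin l → Bit)) ℂ) : Matrix B B ℂ :=
  Matrix.of fun b b' => ∑ v : Fin l → Bit, ∑ v' : Fin l → Bit,
    star (∏ j, basisKet c (w j) (v j)) * σ (b, v) (b', v') * ∏ j, basisKet c (w j) (v' j)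

/-! ### The runs of the gadget with an arbitrary Bob -/

/-- An arbitrary behaviour of Bob during the runs of the gadget. The runs are numbered by `ℕ`. His
whole memory, including all messages he has received and wants to keep, is the system `B`. -/
structure PrepStrategy (l : ℕ) (B : Type) [Fintype B] [DecidableEq B] where
  /-- his initial state -/
  init : Matrix B B ℂ
  init_density : IsDensity init
  /-- how he prepares the `l` qubits that he sends in each of the five steps of a run -/
  send : ℕ → Fin 5 → Channel B (B × (Fin l → Bit))
  /-- what he does with a requested correction -/
  receive : ℕ → Fin 5 → Bit × Bit → Channel B B
  /-- how he produces the bits `(s_1, s_2, s_4, s_5)` that he reports -/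
  announce : ℕ → Instrument (Fin 4 → Bit) B B

section Gadget

variable {l : ℕ} {B : Type} [Fintype B] [DecidableEq B]

/-- One of the five steps of a run: Bob sends `l` qubits, Alice measures, decodes, and requests a
correction. Her physical outcomes are summed over. -/
noncomputable def PrepStrategy.step (S : PrepStrategy l B) (dec : Bit → (Fin l → Bit) → Bit)
    (t : ℕ) (x : Coins) (i : Fin 5) (ρ : Matrix B B ℂ) : Matrix B B ℂ :=
  ∑ w : Fin l → Bit,
    (S.receive t i (correction (x.1 i) (x.2.1 i) (x.2.2 i) (dec (x.1 i) w))).map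
      (measureQubits (x.1 i) w ((S.send t i).map ρ))

/-- A run of the gadget in which Alice's coins are `x` and Bob reports `s`. -/
noncomputable def PrepStrategy.run (S : PrepStrategy l B) (dec : Bit → (Fin l → Bit) → Bit)
    (t : ℕ) (x : Coins) (s : Fin 4 → Bit) (ρ : Matrix B B ℂ) : Matrix B B ℂ :=
  (S.announce t).apply s (Fin.foldl 5 (fun σ i => S.step dec t x i σ) ρ)

/-- Bob's unnormalised state after `M` runs, for given coins of Alice and given reports of Bob. -/
noncomputable def PrepStrategy.state (S : PrepStrategy l B) (dec : Bit → (Fin l → Bit) → Bit)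
    {M : ℕ} (x : Fin M → Coins) (s : Fin M → Fin 4 → Bit) : Matrix B B ℂ :=
  Fin.foldl M (fun σ t => S.run dec t (x t) (s t) σ) S.init

/-- The runs that are kept: those with `s_1 = s_2 = s_4 = s_5 = 0`. -/
abbrev Kept {M : ℕ} (s : Fin M → Fin 4 → Bit) : Type := {t : Fin M // s t = 0}

/-- The joint unnormalised state, after `M` runs in which Bob reported `s`, of Alice's register, which
holds the names of the states in the kept runs, and of Bob's system. -/
noncomputable def PrepStrategy.jointState (S : PrepStrategy l B)
    (dec : Bit → (Fin l → Bit) → Bit) (p p' : ℝ) {M : ℕ} (s : Fin M → Fin 4 → Bit) :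
    Matrix ((Kept s → Label) × B) ((Kept s → Label) × B) ℂ :=
  ∑ x : Fin M → Coins, ((∏ t, coinProb p p' (x t) : ℝ) : ℂ) •
    (Matrix.single (fun t : Kept s => preparedLabel (x t).1 (x t).2.1)
      (fun t : Kept s => preparedLabel (x t).1 (x t).2.1) (1 : ℂ) ⊗ₖ S.state dec x s)

/-- The output of `M` runs in which Bob reported `s`: the joint state, normalised by the probability
of these reports. -/
noncomputable def PrepStrategy.output (S : PrepStrategy l B)
    (dec : Bit → (Fin l → Bit) → Bit) (p p' : ℝ) {M : ℕ} (s : Fin M → Fin 4 → Bit) :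
    Matrix ((Kept s → Label) × B) ((Kept s → Label) × B) ℂ :=
  ((S.jointState dec p p' s).trace)⁻¹ • S.jointState dec p p' s

end Gadget

/-! ### The state-preparation step of the Fitzsimons–Kashefi protocol -/

/-- The probability of each of the ten states, when a fraction `d` of the states are `Z`-basis
states. -/
noncomputable def fkProb (d : ℝ) : Label → ℝ
  | Sum.inl _ => d / 2
  | Sum.inr _ => (1 - d) / 8

/-- The projector `|ψ⟩⟨ψ|` for the product state `ψ` of the qubits with the names `lam`. -/
noncomputable def labelProj {ι : Type} [Fintype ι] (lam : ι → Label) :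
    Matrix (ι → Bit) (ι → Bit) ℂ :=
  Matrix.vecMulVec (fun v => ∏ t, labelKet (lam t) (v t))
    (star fun v => ∏ t, labelKet (lam t) (v t))

/-- Alice sends to Bob independent random qubits, one for each `t : ι`, and keeps their names in a
register; Bob applies the deviation `E` to what he received. -/
noncomputable def fkState {ι B : Type} [Fintype ι] [DecidableEq ι] [Fintype B] [DecidableEq B]
    (d : ℝ) (E : Channel (ι → Bit) B) : Matrix ((ι → Label) × B) ((ι → Label) × B) ℂ :=
  ∑ lam : ι → Label, ((∏ t, fkProb d (lam t) : ℝ) : ℂ) •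
    (Matrix.single lam lam (1 : ℂ) ⊗ₖ E.map (labelProj lam))

/-- The probability that the effect `Q` on Bob's system occurs, `Tr[(1 ⊗ Q) ρ]`. -/
noncomputable def bobProb {R B : Type} [Fintype R] [DecidableEq R] [Fintype B]
    (Q : Matrix B B ℂ) (ρ : Matrix (R × B) (R × B) ℂ) : ℂ :=
  (((1 : Matrix R R ℂ) ⊗ₖ Q) * ρ).trace

/-! ### The whole protocol -/

/-- What a run of the gadget yields: nothing if Bob's report is not zero; otherwise a `Z`-basis state
(`some true`) or one of the states `|+_k⟩` (`some false`). -/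
def runKind (x : Coins) (s : Fin 4 → Bit) : Option Bool :=
  if s = 0 then some (preparedLabel x.1 x.2.1).isLeft else none

/-- After the first `m` of the runs there are at least `ND` `Z`-basis states and at least `N - ND`
states `|+_k⟩`. -/
def Enough (N ND : ℕ) {M : ℕ} (kind : Fin M → Option Bool) (m : ℕ) : Prop :=
  ND ≤ (Finset.univ.filter fun t : Fin M => t.val < m ∧ kind t = some true).card ∧
  N ≤ (Finset.univ.filter fun t : Fin M => t.val < m ∧ kind t = some false).card + ND

/-- The gadget is repeated until enough states are prepared, and this happens after `M` runs. -/
def FinishesAt (N ND : ℕ) {M : ℕ} (kind : Fin M → Option Bool) : Prop :=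
  Enough N ND kind M ∧ ∀ m < M, ¬ Enough N ND kind m

/-- A rule by which Alice picks the run that provides the qubit for each vertex of the graph, given
the kinds of the prepared states: distinct vertices use distinct runs, the dummy vertices `D` get
`Z`-basis states, and the other vertices get states `|+_k⟩`. -/
def IsAssignment {N M : ℕ} (D : Finset (Fin N))
    (assign : (Fin M → Option Bool) → Fin N → Fin M) : Prop :=
  ∀ kind, FinishesAt N D.card kind →
    Function.Injective (assign kind) ∧ ∀ v, kind (assign kind v) = some (decide (v ∈ D))

/-- What Alice delegates, and hides, on `N` vertices with the dummy vertices `D`: the trap vertices,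
and the angle (in units of `π/4`) for each vertex as a function of the corrected outcomes of the
vertices that were measured earlier. The vertices are measured in their order; the angles are
used only for the vertices which are neither dummy nor trap. -/
structure Delegation (N : ℕ) (D : Finset (Fin N)) where
  trap : Finset (Fin N)
  trap_disjoint : Disjoint trap D
  angle : (v : Fin N) → (Fin v.val → Bit) → ZMod 8

/-- Alice's coins `(r, k', φ)` for a vertex; the last two are used for the dummy vertices only. -/
abbrev FKCoins : Type := Bit × ZMod 8 × ZMod 8

/-- The message `δ` for the vertex `v`, in units of `π/4`. Here `lab` are the names of the states on the
vertices, `y` Alice's coins and `b` Bob's replies. -/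
noncomputable def delta {N : ℕ} {D : Finset (Fin N)} (G : SimpleGraph (Fin N))
    (A : Delegation N D) (lab : Fin N → Label) (y : Fin N → FKCoins) (b : Fin N → Bit)
    (v : Fin N) : ZMod 8 :=
  open Classical in
  let k : ZMod 8 := match lab v with
    | Sum.inl _ => (y v).2.1
    | Sum.inr k => k
  let φ : ZMod 8 :=
    if v ∈ D then (y v).2.2
    else if v ∈ A.trap then 0
    else A.angle v fun j =>
      b (Fin.castLE v.isLt.le j) + (y (Fin.castLE v.isLt.le j)).1
  let ones : ℕ := (Finset.univ.filter fun u => G.Adj v u ∧ lab u = Sum.inl 1).card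
  k + φ + 4 * bitToOct (y v).1 + 4 * (ones : ZMod 8)

/-- An arbitrary behaviour of Bob after the runs of the gadget. -/
structure FKStrategy (N : ℕ) (B : Type) [Fintype B] [DecidableEq B] where
  /-- what he does when Alice tells him which run provides the qubit for which vertex -/
  start : (Fin N → ℕ) → Channel B B
  /-- how he produces his reply to the message for a vertex -/
  reply : Fin N → ZMod 8 → Instrument Bit B B

/-- Bob's unnormalised state at the end of the protocol, on the event that the state preparation takes
exactly `M` runs of the gadget, averaged over all of Alice's random choices and summed over Bob's
reports and replies. -/
noncomputable def finalState {l N M : ℕ} {B : Type} [Fintype B] [DecidableEq B]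
    (S : PrepStrategy l B) (F : FKStrategy N B) (dec : Bit → (Fin l → Bit) → Bit) (p p' : ℝ)
    (G : SimpleGraph (Fin N)) {D : Finset (Fin N)}
    (assign : (Fin M → Option Bool) → Fin N → Fin M) (A : Delegation N D) : Matrix B B ℂ :=
  open Classical in
  ∑ x : Fin M → Coins, ∑ s : Fin M → Fin 4 → Bit,
    let kind : Fin M → Option Bool := fun t => runKind (x t) (s t)
    if FinishesAt N D.card kind then
      let run : Fin N → Fin M := assign kind
      let lab : Fin N → Label := fun v => preparedLabel (x (run v)).1 (x (run v)).2.1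
      ((∏ t, coinProb p p' (x t) : ℝ) : ℂ) •
        ∑ y : Fin N → FKCoins, ((1 : ℂ) / (2 * 8 * 8) ^ N) •
          ∑ b : Fin N → Bit,
            Fin.foldl N (fun σ v => (F.reply v (delta G A lab y b v)).apply (b v) σ)
              ((F.start fun v => (run v : ℕ)).map (S.state dec x s))
    else 0

/-! Blindness of the fault-tolerant protocol: Bob's view of every run of the gadget is one-time padded. -/


/-! In each step the requested correction is a one-time pad: for a fixed basis and decoded outcome,
`(a, r)` determines the request bijectively, so a uniform `(a, r)` makes the request uniform
whatever they are. What is left of the measurement, summed over its outcomes, is a partial trace,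
the same for both bases (`PrepStrategy.sum_stepLin`). Hence Bob's averaged evolution in a run
depends neither on the bases nor on their distribution (`PrepStrategy.sum_coinProb_runLin`). The
first claim tests Bob's system alone, so a channel that discards its input and prepares his
normalised marginal suffices.

The second claim involves the correlations between Bob's state and the names. The bits `a` enter the
name of `|+_k⟩` through a power of `Z`, which exchanges `k` and `k + 4`, and through `X^{a_2}`. The
pair `{k, k + 4}` therefore depends only on the bases and on the second bit `a`, and the biases of
the bases give all four pairs equal weight. So Bob's states for `k` and `k + 4` have a sum that does
not depend on `k` (`PrepStrategy.sum_pair_runLin`, `PrepStrategy.labelledState_pair`). Together with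
the uniform bit `r'` this pads the angle in `δ` (`sum_shift_eq`). Since `r'_v` reappears in later
angles, the angles are erased from the last vertex to the first (`sum_delta_eq`).

Evolutions are multilinear in steps and runs, so averages over independent coins are taken factor by
factor. -/

/-! ### Sequential composition of linear maps -/

section Sequential

variable {V : Type} [AddCommGroup V] [Module ℂ V]

/-- The composition `L (n - 1) ∘ ⋯ ∘ L 0` of linear maps, as a multilinear function of them. -/
noncomputable def seqComp (n : ℕ) (V : Type) [AddCommGroup V] [Module ℂ V] :
    MultilinearMap ℂ (fun _ : Fin n => Module.End ℂ V) (Module.End ℂ V) :=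
  -- The algebra product puts index `0` leftmost, but the map applied first must stand rightmost;
  -- hence the reversal.
  (MultilinearMap.mkPiAlgebraFin ℂ n (Module.End ℂ V)).domDomCongr Fin.revPerm

theorem foldl_eq_seqComp {n : ℕ} (L : Fin n → Module.End ℂ V) (σ : V) :
    Fin.foldl n (fun σ i => L i σ) σ = seqComp n V L σ := by
  induction n with
  | zero => simp [seqComp]
  | succ n ih =>
    rw [Fin.foldl_succ_last, ih fun i => L i.castSucc]
    simp [seqComp, List.ofFn_succ, Fin.rev_succ]

theorem sum_prod_smul_seqComp {n : ℕ} {Z : Type} [Fintype Z] (w : Fin n → Z → ℂ)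
    (L : Fin n → Z → Module.End ℂ V) :
    ∑ x : Fin n → Z, (∏ i, w i (x i)) • seqComp n V (fun i => L i (x i)) =
      seqComp n V fun i => ∑ z, w i z • L i z := by
  classical
  rw [MultilinearMap.map_sum]
  exact Finset.sum_congr rfl fun x _ => (MultilinearMap.map_smul_univ _ _ _).symm

end Sequential

/-! ### Linearity of the protocol's operations -/

section Linear

variable {m n O : Type} [Fintype m] [DecidableEq m] [Fintype n] [DecidableEq n] [Fintype O]

/-- `Instrument.apply` as a linear map. -/
noncomputable def Instrument.lin (I : Instrument O m n) (o : O) :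
    Matrix m m ℂ →ₗ[ℂ] Matrix n n ℂ where
  toFun := I.apply o
  map_add' ρ σ := by
    simp [Instrument.apply, Matrix.mul_add, Matrix.add_mul, Finset.sum_add_distrib]
  map_smul' a ρ := by simp [Instrument.apply, Finset.smul_sum]

theorem Instrument.lin_apply (I : Instrument O m n) (o : O) (ρ : Matrix m m ℂ) :
    I.lin o ρ = I.apply o ρ := rfl

theorem Instrument.apply_posSemidef (I : Instrument O m n) (o : O) {ρ : Matrix m m ℂ}
    (h : ρ.PosSemidef) : (I.apply o ρ).PosSemidef :=
  Matrix.posSemidef_sum _ fun _ _ => h.mul_mul_conjTranspose_same _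

variable {l : ℕ} {B : Type} [Fintype B] [DecidableEq B]

/-- The isometry which prepares the `l` qubits in the post-measurement state of `measureQubits`. -/
noncomputable def outcomeIsometry (B : Type) [DecidableEq B] (c : Bit) (w : Fin l → Bit) :
    Matrix (B × (Fin l → Bit)) B ℂ :=
  Matrix.of fun bv b' => if bv.1 = b' then ∏ j, basisKet c (w j) (bv.2 j) else 0

theorem measureQubits_eq (c : Bit) (w : Fin l → Bit)
    (σ : Matrix (B × (Fin l → Bit)) (B × (Fin l → Bit)) ℂ) :
    measureQubits c w σ = (outcomeIsometry B c w)ᴴ * σ * outcomeIsometry B c w := by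
  ext b b'
  rw [Matrix.mul_assoc]
  simp only [measureQubits, outcomeIsometry, Matrix.mul_apply, Matrix.conjTranspose_apply,
    Matrix.of_apply, Fintype.sum_prod_type, mul_ite, mul_zero, apply_ite star, star_zero, ite_mul,
    zero_mul]
  rw [Finset.sum_eq_single b (fun x _ h => by simp [h]) (by simp)]
  refine Finset.sum_congr rfl fun v _ => ?_
  rw [Finset.sum_eq_single b' (fun x _ h => by simp [h]) (by simp)]
  simp [Finset.mul_sum, mul_assoc]

/-- `measureQubits` as a linear map. -/
noncomputable def measureLin (c : Bit) (w : Fin l → Bit) :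
    Matrix (B × (Fin l → Bit)) (B × (Fin l → Bit)) ℂ →ₗ[ℂ] Matrix B B ℂ where
  toFun := measureQubits c w
  map_add' ρ σ := by simp [measureQubits_eq, Matrix.mul_add, Matrix.add_mul]
  map_smul' a ρ := by simp [measureQubits_eq]

theorem measureLin_apply (c : Bit) (w : Fin l → Bit)
    (σ : Matrix (B × (Fin l → Bit)) (B × (Fin l → Bit)) ℂ) :
    measureLin c w σ = measureQubits c w σ := rfl

theorem measureQubits_posSemidef (c : Bit) (w : Fin l → Bit)
    {σ : Matrix (B × (Fin l → Bit)) (B × (Fin l → Bit)) ℂ} (h : σ.PosSemidef) :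
    (measureQubits c w σ).PosSemidef := by
  rw [measureQubits_eq]
  exact h.conjTranspose_mul_mul_same _

theorem sum_bit {A : Type} [AddCommMonoid A] (f : Bit → A) : ∑ b, f b = f 0 + f 1 :=
  Fin.sum_univ_two f

theorem bit_eq_zero_or_one (b : Bit) : b = 0 ∨ b = 1 := by revert b; decide

theorem basisKet_resolution (c v v' : Bit) :
    ∑ a, star (basisKet c a v) * basisKet c a v' = if v = v' then 1 else 0 := by
  have h : ((Real.sqrt 2 : ℂ))⁻¹ * (Real.sqrt 2 : ℂ)⁻¹ = 1 / 2 := by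
    rw [← mul_inv, ← Complex.ofReal_mul, Real.mul_self_sqrt (by norm_num)]; norm_num
  rw [sum_bit]
  obtain rfl | rfl := bit_eq_zero_or_one c <;> obtain rfl | rfl := bit_eq_zero_or_one v <;>
    obtain rfl | rfl := bit_eq_zero_or_one v' <;> simp [basisKet, ZMod.val_one, h] <;> norm_num

/-- The total effect of Alice's measurement is to discard the qubits. -/
theorem sum_measureQubits {B : Type} (c : Bit) (σ : Matrix (B × (Fin l → Bit)) (B × (Fin l → Bit)) ℂ) :
    ∑ w, measureQubits c w σ = Matrix.of fun b b' => ∑ v, σ (b, v) (b', v) := by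
  have key : ∀ v v' : Fin l → Bit,
      ∑ w : Fin l → Bit, star (∏ j, basisKet c (w j) (v j)) * ∏ j, basisKet c (w j) (v' j) =
        if v = v' then 1 else 0 := by
    intro v v'
    calc _ = ∑ w : Fin l → Bit, ∏ j, (star (basisKet c (w j) (v j)) * basisKet c (w j) (v' j)) := by
          simp [Finset.prod_mul_distrib]
      _ = ∏ j, ∑ a, star (basisKet c a (v j)) * basisKet c a (v' j) := by
          rw [Finset.prod_univ_sum, Fintype.piFinset_univ]
      _ = _ := by
          simp only [basisKet_resolution, funext_iff]
          rw [Fintype.prod_ite_zero]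
          simp
  ext b b'
  simp only [Matrix.sum_apply, measureQubits, Matrix.of_apply]
  rw [Finset.sum_comm]
  refine Finset.sum_congr rfl fun v _ => ?_
  rw [Finset.sum_comm]
  calc _ = ∑ v', σ (b, v) (b', v') * if v = v' then 1 else 0 := by
        refine Finset.sum_congr rfl fun v' _ => ?_
        rw [← key v v', Finset.mul_sum]
        exact Finset.sum_congr rfl fun w _ => by ring
    _ = _ := by simp

end Linear

/-! ### The gadget, averaged over Alice's coins -/

section Gadget

variable {l : ℕ} {B : Type} [Fintype B] [DecidableEq B]

/-- One step of a run, as a linear map, for given coins of that step. -/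
noncomputable def PrepStrategy.stepLin (S : PrepStrategy l B) (dec : Bit → (Fin l → Bit) → Bit)
    (t : ℕ) (i : Fin 5) (c a r : Bit) : Module.End ℂ (Matrix B B ℂ) :=
  ∑ w : Fin l → Bit, (S.receive t i (correction c a r (dec c w))).lin () ∘ₗ
    measureLin c w ∘ₗ (S.send t i).lin ()

theorem PrepStrategy.stepLin_apply (S : PrepStrategy l B) (dec : Bit → (Fin l → Bit) → Bit)
    (t : ℕ) (x : Coins) (i : Fin 5) (ρ : Matrix B B ℂ) :
    S.stepLin dec t i (x.1 i) (x.2.1 i) (x.2.2 i) ρ = S.step dec t x i ρ := by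
  simp [PrepStrategy.stepLin, PrepStrategy.step, LinearMap.sum_apply, Instrument.lin_apply,
    measureLin_apply, Channel.map]

/-- The one-time pad: one exponent is `a` shifted by `o`, the other is `r`, and the basis only
decides which is which. -/
theorem correction_bijective (c o : Bit) :
    Function.Bijective fun u : Bit × Bit => correction c u.1 u.2 o := by
  revert c o; decide

/-- Averaged over `a` and `r`, a step does not reveal the basis. -/
theorem PrepStrategy.sum_stepLin (S : PrepStrategy l B) (dec : Bit → (Fin l → Bit) → Bit)
    (t : ℕ) (i : Fin 5) (c : Bit) :
    ∑ a, ∑ r, S.stepLin dec t i c a r = ∑ a, ∑ r, S.stepLin dec t i 0 a r := by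
  -- The right-hand side is free of `c`: the qubits are traced out and every request `u` occurs
  -- once.
  suffices h : ∀ c ρ, (∑ a, ∑ r, S.stepLin dec t i c a r) ρ =
      ∑ u : Bit × Bit, (S.receive t i u).lin ()
        (Matrix.of fun b b' => ∑ v, (S.send t i).lin () ρ (b, v) (b', v)) by
    ext1 ρ
    rw [h, h]
  intro c ρ
  have h1 : ∀ w : Fin l → Bit, ∑ u : Bit × Bit,
      (S.receive t i (correction c u.1 u.2 (dec c w))).lin ()
        (measureLin c w ((S.send t i).lin () ρ)) =
      ∑ u, (S.receive t i u).lin () (measureLin c w ((S.send t i).lin () ρ)) := fun w =>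
    (correction_bijective c (dec c w)).sum_comp
      fun u => (S.receive t i u).lin () (measureLin c w ((S.send t i).lin () ρ))
  rw [← Fintype.sum_prod_type' (f := fun a r => S.stepLin dec t i c a r)]
  simp only [LinearMap.sum_apply, PrepStrategy.stepLin, LinearMap.comp_apply]
  rw [Finset.sum_comm]
  simp only [h1]
  rw [Finset.sum_comm]
  refine Finset.sum_congr rfl fun u _ => ?_
  rw [← map_sum]
  simp only [measureLin_apply, sum_measureQubits]

/-- A run of the gadget as a linear map. -/
noncomputable def PrepStrategy.runLin (S : PrepStrategy l B) (dec : Bit → (Fin l → Bit) → Bit)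
    (t : ℕ) (x : Coins) (s : Fin 4 → Bit) : Module.End ℂ (Matrix B B ℂ) :=
  (S.announce t).lin s * seqComp 5 _ fun i => S.stepLin dec t i (x.1 i) (x.2.1 i) (x.2.2 i)

theorem PrepStrategy.runLin_apply (S : PrepStrategy l B) (dec : Bit → (Fin l → Bit) → Bit)
    (t : ℕ) (x : Coins) (s : Fin 4 → Bit) (ρ : Matrix B B ℂ) :
    S.runLin dec t x s ρ = S.run dec t x s ρ := by
  simp only [PrepStrategy.runLin, Module.End.mul_apply, ← foldl_eq_seqComp,
    PrepStrategy.stepLin_apply]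
  rfl

theorem PrepStrategy.state_eq (S : PrepStrategy l B) (dec : Bit → (Fin l → Bit) → Bit)
    {M : ℕ} (x : Fin M → Coins) (s : Fin M → Fin 4 → Bit) :
    S.state dec x s = seqComp M _ (fun t => S.runLin dec t (x t) (s t)) S.init := by
  rw [← foldl_eq_seqComp]
  simp only [PrepStrategy.runLin_apply]
  rfl

/-- A step, summed over `a` and `r`. -/
noncomputable def PrepStrategy.stepSum (S : PrepStrategy l B) (dec : Bit → (Fin l → Bit) → Bit)
    (t : ℕ) (i : Fin 5) : Module.End ℂ (Matrix B B ℂ) :=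
  ∑ a, ∑ r, S.stepLin dec t i 0 a r

/-- A run, summed over all bits `a` and `r`. -/
noncomputable def PrepStrategy.runSum (S : PrepStrategy l B) (dec : Bit → (Fin l → Bit) → Bit)
    (t : ℕ) (s : Fin 4 → Bit) : Module.End ℂ (Matrix B B ℂ) :=
  (S.announce t).lin s * seqComp 5 _ (S.stepSum dec t)

/-- A run, summed over all bits `a` and `r` except for the bit `a` of the second step. -/
noncomputable def PrepStrategy.runSumGiven (S : PrepStrategy l B)
    (dec : Bit → (Fin l → Bit) → Bit) (t : ℕ) (s : Fin 4 → Bit) (c a : Bit) :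
    Module.End ℂ (Matrix B B ℂ) :=
  (S.announce t).lin s *
    seqComp 5 _ (Function.update (S.stepSum dec t) 1 (∑ r, S.stepLin dec t 1 c a r))

theorem PrepStrategy.sum_runSumGiven (S : PrepStrategy l B) (dec : Bit → (Fin l → Bit) → Bit)
    (t : ℕ) (s : Fin 4 → Bit) (c : Bit) :
    ∑ a, S.runSumGiven dec t s c a = S.runSum dec t s := by
  simp only [PrepStrategy.runSumGiven, ← Finset.mul_sum]
  rw [← MultilinearMap.map_update_sum, S.sum_stepLin dec t 1 c]
  exact congrArg (fun L => (S.announce t).lin s * seqComp 5 _ L)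
    (Function.update_eq_self 1 (S.stepSum dec t))

/-- The weight sees the padding bits only through `a` of the second step. All other steps are summed
freely over `a` and `r` and forget their bases; only the second step keeps its own. -/
theorem PrepStrategy.sum_smul_runLin (S : PrepStrategy l B) (dec : Bit → (Fin l → Bit) → Bit)
    (t : ℕ) (s : Fin 4 → Bit) (g : (Fin 5 → Bit) → Bit → ℂ) :
    ∑ x : Coins, g x.1 (x.2.1 1) • S.runLin dec t x s =
      ∑ c, ∑ a, g c a • S.runSumGiven dec t s (c 1) a := by
  rw [Fintype.sum_prod_type]
  refine Finset.sum_congr rfl fun c _ => ?_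
  rw [Fintype.sum_prod_type]
  simp only [PrepStrategy.runLin, PrepStrategy.runSumGiven, ← mul_smul_comm, ← Finset.mul_sum,
    ← Finset.smul_sum, ← MultilinearMap.map_update_smul, ← MultilinearMap.map_update_sum]
  congr 1
  have h1 : ∀ a : Fin 5 → Bit,
      ∑ r : Fin 5 → Bit, seqComp 5 _ (fun i => S.stepLin dec t i (c i) (a i) (r i)) =
      seqComp 5 _ fun i => ∑ r, S.stepLin dec t i (c i) (a i) r := fun a =>
    (MultilinearMap.map_sum _ _).symm
  simp only [h1]
  -- The weight as a product over the steps whose only nontrivial factor is the second.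
  have h2 := sum_prod_smul_seqComp (fun (i : Fin 5) (a : Bit) => if i = 1 then g c a else 1)
    fun i a => ∑ r, S.stepLin dec t i (c i) a r
  simp only [Finset.prod_ite_eq', Finset.mem_univ, if_true] at h2
  rw [h2]
  congr 1
  ext1 i
  by_cases hi : i = 1
  · subst hi; simp
  · simp [hi, S.sum_stepLin dec t i (c i), PrepStrategy.stepSum]

theorem sum_fin_succ_fun {n : ℕ} {Z A : Type} [Fintype Z] [AddCommMonoid A]
    (g : (Fin (n + 1) → Z) → A) :
    ∑ f, g f = ∑ z, ∑ f : Fin n → Z, g (Fin.cons z f) := by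
  rw [← Fintype.sum_prod_type']
  exact (Fintype.sum_equiv (Fin.consEquiv fun _ => Z) _ _ fun _ => rfl).symm

theorem sum_fin_five_fun {A : Type} [AddCommMonoid A] (g : (Fin 5 → Bit) → A) :
    ∑ f, g f = ∑ c0, ∑ c1, ∑ c2, ∑ c3, ∑ c4, g ![c0, c1, c2, c3, c4] := by
  simp only [sum_fin_succ_fun, Fintype.sum_unique]
  rfl

/-- Averaged over all coins, a run does not reveal anything, and the distribution of the bases is
irrelevant. -/
theorem PrepStrategy.sum_coinProb_runLin (S : PrepStrategy l B)
    (dec : Bit → (Fin l → Bit) → Bit) (t : ℕ) (s : Fin 4 → Bit) (p p' : ℝ) :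
    ∑ x : Coins, (coinProb p p' x : ℂ) • S.runLin dec t x s =
      (1 / 2 ^ 10 : ℂ) • S.runSum dec t s := by
  have h := S.sum_smul_runLin dec t s fun c _ =>
    (((∏ i, (if c i = 1 then basisProb p p' i else 1 - basisProb p p' i)) *
      (1 / 2 ^ 5) * (1 / 2 ^ 5) : ℝ) : ℂ)
  simp only [← Finset.smul_sum, S.sum_runSumGiven, ← Finset.sum_smul] at h
  refine h.trans ?_
  congr 1
  -- The basis probabilities sum to `1`, which leaves the `2 ^ (-10)` of the uniform bits.
  rw [← Complex.ofReal_sum, ← Finset.sum_mul, ← Finset.sum_mul,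
    ← Fintype.piFinset_univ, ← Finset.prod_univ_sum (fun _ => Finset.univ) fun i c =>
      if c = (1 : Bit) then basisProb p p' i else 1 - basisProb p p' i]
  simp [sum_bit]
  norm_num

end Gadget

/-! ### State preparation -/

section Constant

variable {m n : Type} [Fintype m] [DecidableEq m] [Fintype n] [DecidableEq n]

/-- Discarding the input and preparing a fixed state is a TPCP map. -/
theorem exists_channel_map_eq_trace_smul {τ : Matrix n n ℂ} (hτ : IsDensity τ) :
    ∃ E : Channel m n, ∀ σ, E.map σ = σ.trace • τ := by
  obtain ⟨r, v, hv⟩ := Matrix.posSemidef_iff_eq_sum_vecMulVec.1 hτ.1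
  -- With `τ = ∑ |v_j⟩⟨v_j|`, the Kraus operators are `|v_j⟩⟨i|`; completeness is `Tr τ = 1`.
  let K : Fin r × m → Matrix n m ℂ := fun u => Matrix.vecMulVec (v u.1) (Pi.single u.2 1)
  let e := Fintype.equivFin (Fin r × m)
  have htr : ∑ j, ∑ b, star (v j b) * v j b = 1 := by
    rw [← hτ.2, hv, Matrix.trace_sum]
    simp [Matrix.trace_vecMulVec, dotProduct, mul_comm]
  refine ⟨⟨Fintype.card (Fin r × m), fun _ j => K (e.symm j), ?_⟩, fun σ => ?_⟩
  · simp only [Finset.univ_unique, Finset.sum_singleton]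
    rw [e.symm.sum_comp fun u => (K u)ᴴ * K u]
    ext i i'
    simp only [K, Matrix.sum_apply, Matrix.mul_apply, Matrix.conjTranspose_apply,
      Matrix.vecMulVec_apply, Fintype.sum_prod_type, Pi.single_apply]
    rw [Matrix.one_apply]
    by_cases h : i = i'
    · subst h
      simpa [apply_ite star] using htr
    · simp [h, apply_ite star]
  · change ∑ j, K (e.symm j) * σ * (K (e.symm j))ᴴ = _
    rw [e.symm.sum_comp fun u => K u * σ * (K u)ᴴ]
    ext b b'
    rw [hv]
    simp only [K, Matrix.sum_apply, Matrix.mul_apply, Matrix.conjTranspose_apply,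
      Matrix.vecMulVec_apply, Fintype.sum_prod_type, Pi.single_apply, Matrix.smul_apply,
      smul_eq_mul, Matrix.trace, Matrix.diag_apply]
    simp only [mul_ite, mul_one, mul_zero, apply_ite star, star_zero, ite_mul, zero_mul,
      Finset.sum_ite_eq', Finset.mem_univ, if_true]
    rw [Finset.sum_mul_sum, Finset.sum_comm]
    exact Finset.sum_congr rfl fun _ _ => Finset.sum_congr rfl fun _ _ => by
      rw [Pi.star_apply]; ring

end Constant

theorem sum_labelKet_normSq (lam : Label) : ∑ v, labelKet lam v * star (labelKet lam v) = 1 := by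
  have h : ((Real.sqrt 2 : ℂ))⁻¹ * (Real.sqrt 2 : ℂ)⁻¹ = 1 / 2 := by
    rw [← mul_inv, ← Complex.ofReal_mul, Real.mul_self_sqrt (by norm_num)]; norm_num
  rw [sum_bit]
  obtain z | k := lam
  · obtain rfl | rfl := bit_eq_zero_or_one z <;> simp [labelKet, basisKet]
  · have h1 : ∀ x : ℝ, Complex.exp (x * Complex.I) * (starRingEnd ℂ) (Complex.exp (x * Complex.I)) = 1 :=
      fun x => by rw [Complex.mul_conj, Complex.normSq_eq_norm_sq, Complex.norm_exp_ofReal_mul_I]; simp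
    have h2 := h1 ((k.val : ℝ) * (Real.pi / 4))
    push_cast at h2
    simp only [labelKet, plusKet, Complex.star_def, map_mul, one_div, map_inv₀, Complex.conj_ofReal,
      if_true, mul_one, one_ne_zero, if_false, h]
    push_cast
    rw [mul_mul_mul_comm, h, h2]
    norm_num

theorem trace_labelProj {ι : Type} [Fintype ι] [DecidableEq ι] (lam : ι → Label) :
    (labelProj lam).trace = 1 := by
  simp only [labelProj, Matrix.trace_vecMulVec, dotProduct, Pi.star_apply, star_prod,
    ← Finset.prod_mul_distrib]
  rw [← Fintype.piFinset_univ, ← Finset.prod_univ_sum (fun _ => Finset.univ) fun t v =>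
    labelKet (lam t) v * star (labelKet (lam t) v)]
  simp only [sum_labelKet_normSq, Finset.prod_const_one]

theorem sum_fkProb (d : ℝ) : ∑ lam, fkProb d lam = 1 := by
  rw [Fintype.sum_sum_type]
  simp [fkProb]
  ring

/-- Alice's register is classical, so an effect on Bob's side sees only the average of his
conditional states. -/
theorem bobProb_sum_single {R B : Type} [Fintype R] [DecidableEq R] [Fintype B] {X : Type}
    [Fintype X] (Q : Matrix B B ℂ) (w : X → ℂ) (f : X → R) (ρ : X → Matrix B B ℂ) :
    bobProb Q (∑ x, w x • (Matrix.single (f x) (f x) (1 : ℂ) ⊗ₖ ρ x)) =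
      (Q * ∑ x, w x • ρ x).trace := by
  simp only [bobProb, Matrix.mul_sum, Matrix.trace_sum, Matrix.mul_smul, Matrix.trace_smul,
    ← Matrix.mul_kronecker_mul, Matrix.trace_kronecker, one_mul, Matrix.trace_single_eq_same]

/-! ### Bob's marginal and its simulation -/

section Preparation

variable {l : ℕ} {B : Type} [Fintype B] [DecidableEq B]

/-- Bob's part of the output of the state preparation, unnormalised. -/
noncomputable def PrepStrategy.marginal (S : PrepStrategy l B)
    (dec : Bit → (Fin l → Bit) → Bit) {M : ℕ} (s : Fin M → Fin 4 → Bit) : Matrix B B ℂ :=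
  seqComp M _ (fun t => (1 / 2 ^ 10 : ℂ) • S.runSum dec t (s t)) S.init

/-- The coins of different runs are independent, so the average factorises, and no factor depends on
`p` or `p'`. This allows the channel to be chosen before them. -/
theorem PrepStrategy.sum_coinProb_state (S : PrepStrategy l B)
    (dec : Bit → (Fin l → Bit) → Bit) (p p' : ℝ) {M : ℕ} (s : Fin M → Fin 4 → Bit) :
    ∑ x : Fin M → Coins, ((∏ t, coinProb p p' (x t) : ℝ) : ℂ) • S.state dec x s =
      S.marginal dec s := by
  have h := sum_prod_smul_seqComp (fun (_ : Fin M) x => (coinProb p p' x : ℂ))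
    fun t x => S.runLin dec t x (s t)
  simp only [S.sum_coinProb_runLin] at h
  rw [PrepStrategy.marginal, ← h]
  simp [PrepStrategy.state_eq, LinearMap.sum_apply]

theorem PrepStrategy.bobProb_jointState (S : PrepStrategy l B)
    (dec : Bit → (Fin l → Bit) → Bit) (p p' : ℝ) {M : ℕ} (s : Fin M → Fin 4 → Bit)
    (Q : Matrix B B ℂ) :
    bobProb Q (S.jointState dec p p' s) = (Q * S.marginal dec s).trace := by
  rw [PrepStrategy.jointState, bobProb_sum_single, S.sum_coinProb_state]

theorem PrepStrategy.trace_jointState (S : PrepStrategy l B)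
    (dec : Bit → (Fin l → Bit) → Bit) (p p' : ℝ) {M : ℕ} (s : Fin M → Fin 4 → Bit) :
    (S.jointState dec p p' s).trace = (S.marginal dec s).trace := by
  have h := S.bobProb_jointState dec p p' s 1
  simpa [bobProb] using h

theorem PrepStrategy.step_posSemidef (S : PrepStrategy l B) (dec : Bit → (Fin l → Bit) → Bit)
    (t : ℕ) (x : Coins) (i : Fin 5) {ρ : Matrix B B ℂ} (h : ρ.PosSemidef) :
    (S.step dec t x i ρ).PosSemidef :=
  Matrix.posSemidef_sum _ fun _ _ => Instrument.apply_posSemidef _ _ <|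
    measureQubits_posSemidef _ _ <| Instrument.apply_posSemidef _ _ h

theorem foldl_induction {A : Type} (P : A → Prop) {n : ℕ} (f : A → Fin n → A)
    (hf : ∀ a i, P a → P (f a i)) (a : A) (ha : P a) : P (Fin.foldl n f a) := by
  induction n with
  | zero => simpa using ha
  | succ n ih =>
    rw [Fin.foldl_succ_last]
    exact hf _ _ (ih (fun a i => f a i.castSucc) fun a i => hf a _)

theorem PrepStrategy.state_posSemidef (S : PrepStrategy l B)
    (dec : Bit → (Fin l → Bit) → Bit) {M : ℕ} (x : Fin M → Coins) (s : Fin M → Fin 4 → Bit) :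
    (S.state dec x s).PosSemidef :=
  foldl_induction _ _ (fun _ t hσ => Instrument.apply_posSemidef _ _ <|
    foldl_induction _ _ (fun _ i hρ => S.step_posSemidef dec t (x t) i hρ) _ hσ) _ S.init_density.1

theorem PrepStrategy.marginal_posSemidef (S : PrepStrategy l B)
    (dec : Bit → (Fin l → Bit) → Bit) {M : ℕ} (s : Fin M → Fin 4 → Bit) :
    (S.marginal dec s).PosSemidef := by
  -- The marginal is the same for all parameters; at `1 / 2` all coin weights are genuine
  -- probabilities.
  rw [← S.sum_coinProb_state dec (1 / 2) (1 / 2) s]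
  refine Matrix.posSemidef_sum _ fun x _ => (S.state_posSemidef dec x s).smul ?_
  rw [Complex.zero_le_real]
  refine Finset.prod_nonneg fun t _ => mul_nonneg (mul_nonneg (Finset.prod_nonneg fun i _ => ?_)
    (by norm_num)) (by norm_num)
  have hi : 0 ≤ basisProb (1 / 2) (1 / 2) i ∧ basisProb (1 / 2) (1 / 2) i ≤ 1 := by
    fin_cases i <;> norm_num [basisProb]
  split_ifs <;> linarith

/-- Bob can simulate the output of the state preparation on his own: he tosses Alice's coins
himself, and the joint state is only seen through his own system. -/
theorem PrepStrategy.exists_channel (S : PrepStrategy l B) (dec : Bit → (Fin l → Bit) → Bit)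
    {M : ℕ} (s : Fin M → Fin 4 → Bit) :
    ∃ E : Channel (Kept s → Bit) B, ∀ p p' d : ℝ, (S.jointState dec p p' s).trace ≠ 0 →
      ∀ Q : Matrix B B ℂ, bobProb Q (S.output dec p p' s) = bobProb Q (fkState d E) := by
  have hpos := S.marginal_posSemidef dec s
  -- For reports of probability zero nothing can be normalised, and any channel serves.
  by_cases h0 : (S.marginal dec s).trace = 0
  · obtain ⟨E, -⟩ := exists_channel_map_eq_trace_smul (m := Kept s → Bit) S.init_density
    exact ⟨E, fun p p' _ h => (h (by rw [S.trace_jointState, h0])).elim⟩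
  obtain ⟨E, hE⟩ := exists_channel_map_eq_trace_smul (m := Kept s → Bit)
    (τ := (S.marginal dec s).trace⁻¹ • S.marginal dec s)
    ⟨hpos.smul (inv_nonneg.2 hpos.trace_nonneg), by simp [Matrix.trace_smul, h0]⟩
  refine ⟨E, fun p p' d _ Q => ?_⟩
  have hsum : ∑ lam : Kept s → Label, ((∏ t, fkProb d (lam t) : ℝ) : ℂ) = 1 := by
    rw [← Complex.ofReal_sum, ← Fintype.piFinset_univ,
      ← Finset.prod_univ_sum (fun _ => Finset.univ) fun _ lam => fkProb d lam]
    simp only [sum_fkProb, Finset.prod_const_one, Complex.ofReal_one]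
  have hout : bobProb Q (S.output dec p p' s) =
      (S.marginal dec s).trace⁻¹ * (Q * S.marginal dec s).trace := by
    rw [← S.bobProb_jointState dec p p', ← S.trace_jointState dec p p']
    simp [bobProb, PrepStrategy.output]
  rw [hout, fkState, bobProb_sum_single]
  simp only [hE, trace_labelProj, one_smul, ← Finset.sum_smul, hsum]
  simp

end Preparation

/-! ### The states `|+_k⟩` and `|+_{k+4}⟩` together -/

/-- For given bases `c` and a given bit `a` of the second step, one of `|+_k⟩` and `|+_{k+4}⟩` is
prepared. -/
def preparesPair (k : ZMod 8) (c : Fin 5 → Bit) (a : Bit) : Prop :=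
  if c 2 = 0 then False
  else if c 1 = 0 then
    if c 3 = 0 then k = 0 ∨ k = 4
    else if c 4 = 0 then False
    else k = 2 ∨ k = 6
  else if c 0 = 0 then False
  else if c 3 = 0 then if a = 0 then k = 1 ∨ k = 5 else k = 3 ∨ k = 7
  else if c 4 = 0 then False
  else if a = 0 then k = 3 ∨ k = 7 else k = 1 ∨ k = 5

instance (k : ZMod 8) (c : Fin 5 → Bit) (a : Bit) : Decidable (preparesPair k c a) := by
  unfold preparesPair; infer_instance

/-- The exponent of `Z` adds a multiple of `4` and stays within the pair; `X` negates `k` and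
exchanges `{1, 5}` with `{3, 7}`. -/
theorem preparedLabel_pair_iff (k : ZMod 8) (c a : Fin 5 → Bit) :
    (preparedLabel c a = Sum.inr k ∨ preparedLabel c a = Sum.inr (k + 4)) ↔
      preparesPair k c (a 1) := by
  have h1 : ∀ (k : ZMod 8) (u : Bit),
      (4 * bitToOct u = k ∨ 4 * bitToOct u = k + 4) ↔ (k = 0 ∨ k = 4) := by decide
  have h2 : ∀ (k : ZMod 8) (u : Bit),
      (2 + 4 * bitToOct u = k ∨ 2 + 4 * bitToOct u = k + 4) ↔ (k = 2 ∨ k = 6) := by decide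
  have h3 : ∀ (k : ZMod 8) (b u : Bit),
      ((if b = 0 then 1 else -1) * (1 + 4 * bitToOct u) = k ∨
        (if b = 0 then 1 else -1) * (1 + 4 * bitToOct u) = k + 4) ↔
      if b = 0 then k = 1 ∨ k = 5 else k = 3 ∨ k = 7 := by decide
  have h4 : ∀ (k : ZMod 8) (b u : Bit),
      ((if b = 0 then 1 else -1) * (3 + 4 * bitToOct u) = k ∨
        (if b = 0 then 1 else -1) * (3 + 4 * bitToOct u) = k + 4) ↔
      if b = 0 then k = 3 ∨ k = 7 else k = 1 ∨ k = 5 := by decide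
  unfold preparedLabel preparesPair
  split_ifs with c2 c1 c3 c4 c0 c3 a1 c4 a1 <;> simp only [or_self, Sum.inr.injEq]
  · exact h1 k _
  · exact h2 k _
  · simpa [a1] using h3 k (a 1) (a 0 + a 2 + a 3)
  · simpa [a1] using h3 k (a 1) (a 0 + a 2 + a 3)
  · simpa [a1] using h4 k (a 1) (a 0 + a 1 + a 2 + a 3 + a 4)
  · simpa [a1] using h4 k (a 1) (a 0 + a 1 + a 2 + a 3 + a 4)

/-- The bias `p / (1 - p)` is tuned for this: `c 1 = 0` and `c 0 = c 1 = 1` both have weight `p`,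
and so do `c 3 = 0` and `c 3 = c 4 = 1`. Each pair arises from one choice in each alternative
together with `c 2 = 1`; the bit `a` only exchanges branches of equal weight. -/
theorem sum_preparesPair {p : ℝ} (hp : p ≠ 1) (p' : ℝ) (k : ZMod 8) (c1 a : Bit) :
    ∑ c0, ∑ c2, ∑ c3, ∑ c4, (if preparesPair k ![c0, c1, c2, c3, c4] a then
      ∏ i, (if (![c0, c1, c2, c3, c4] : Fin 5 → Bit) i = 1 then basisProb p p' i
        else 1 - basisProb p p' i) else 0) =
      if c1 = 0 ↔ k = 0 ∨ k = 2 ∨ k = 4 ∨ k = 6 then p ^ 2 * (1 - p') else 0 := by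
  have hp' : 1 - p ≠ 0 := sub_ne_zero.2 hp.symm
  have hk : k = 0 ∨ k = 1 ∨ k = 2 ∨ k = 3 ∨ k = 4 ∨ k = 5 ∨ k = 6 ∨ k = 7 := by
    revert k; decide
  obtain rfl | rfl := bit_eq_zero_or_one c1 <;> obtain rfl | rfl := bit_eq_zero_or_one a <;>
    obtain rfl | rfl | rfl | rfl | rfl | rfl | rfl | rfl := hk <;>
    simp +decide [sum_bit, preparesPair, Fin.prod_univ_five, basisProb] <;> field_simp <;> ring

section Pair

variable {l : ℕ} {B : Type} [Fintype B] [DecidableEq B]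

/-- The weight of a pair does not depend on `a`, so the second step is also summed freely and
forgets its basis, which was the last trace of `k`. -/
theorem PrepStrategy.sum_pair_runLin (S : PrepStrategy l B) (dec : Bit → (Fin l → Bit) → Bit)
    (t : ℕ) (s : Fin 4 → Bit) {p : ℝ} (hp : p ≠ 1) (p' : ℝ) (k : ZMod 8) :
    ∑ x : Coins, (if preparedLabel x.1 x.2.1 = Sum.inr k ∨
        preparedLabel x.1 x.2.1 = Sum.inr (k + 4) then (coinProb p p' x : ℂ) else 0) •
          S.runLin dec t x s =
      ((p ^ 2 * (1 - p') / 2 ^ 10 : ℝ) : ℂ) • S.runSum dec t s := by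
  have h := S.sum_smul_runLin dec t s fun c a => (((if preparesPair k c a then
    ∏ i, (if c i = 1 then basisProb p p' i else 1 - basisProb p p' i) else 0) / 2 ^ 10 : ℝ) : ℂ)
  have hw : ∀ x : Coins, (if preparedLabel x.1 x.2.1 = Sum.inr k ∨
      preparedLabel x.1 x.2.1 = Sum.inr (k + 4) then (coinProb p p' x : ℂ) else 0) =
      (((if preparesPair k x.1 (x.2.1 1) then ∏ i, (if x.1 i = 1 then basisProb p p' i
        else 1 - basisProb p p' i) else 0) / 2 ^ 10 : ℝ) : ℂ) := by
    intro x
    simp only [preparedLabel_pair_iff]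
    split_ifs
    · congr 1; rw [coinProb]; ring
    · simp
  simp only [hw, h]
  rw [Finset.sum_comm]
  have hc : ∀ a, ∑ c : Fin 5 → Bit, (((if preparesPair k c a then
      ∏ i, (if c i = 1 then basisProb p p' i else 1 - basisProb p p' i) else 0) / 2 ^ 10 : ℝ) : ℂ) •
        S.runSumGiven dec t s (c 1) a =
      ∑ c1, (((if c1 = 0 ↔ k = 0 ∨ k = 2 ∨ k = 4 ∨ k = 6 then p ^ 2 * (1 - p') else 0) /
        2 ^ 10 : ℝ) : ℂ) • S.runSumGiven dec t s c1 a := by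
    intro a
    rw [sum_fin_five_fun, Finset.sum_comm]
    refine Finset.sum_congr rfl fun c1 _ => ?_
    simp only [Matrix.cons_val_one, Matrix.cons_val_zero]
    simp only [← Finset.sum_smul, ← Complex.ofReal_sum, ← Finset.sum_div, sum_preparesPair hp]
  rw [Finset.sum_congr rfl fun a _ => hc a, Finset.sum_comm, sum_bit]
  simp only [← Finset.smul_sum, S.sum_runSumGiven]
  -- Exactly one value of the second basis contributes: `0` for even `k`, `1` for odd `k`.
  by_cases hk : k = 0 ∨ k = 2 ∨ k = 4 ∨ k = 6 <;> simp [hk]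

end Pair

/-! ### Bob's state for given kinds of runs and given names of the assigned states -/

/-- A linear combination of linear maps. -/
noncomputable def weightedSum {X n : Type} [Fintype X] (w : X → ℂ)
    (L : X → Module.End ℂ (Matrix n n ℂ)) : Module.End ℂ (Matrix n n ℂ) :=
  ∑ x, w x • L x

theorem weightedSum_add {X n : Type} [Fintype X] {w w' w'' : X → ℂ}
    (h : ∀ x, w x + w' x = w'' x) (L : X → Module.End ℂ (Matrix n n ℂ)) :
    weightedSum w L + weightedSum w' L = weightedSum w'' L := by
  simp only [weightedSum, ← h, add_smul, Finset.sum_add_distrib]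

theorem weightedSum_zero {X n : Type} [Fintype X] {w : X → ℂ} (h : ∀ x, w x = 0)
    (L : X → Module.End ℂ (Matrix n n ℂ)) : weightedSum w L = 0 := by
  simp [weightedSum, h]

section Labelled

variable {l : ℕ} {B : Type} [Fintype B] [DecidableEq B] {M N : ℕ}

/-- The coins of run `t` yield the kind `κ` and, if `t` is assigned to a vertex, the state named by
`lab` on that vertex. -/
def IsCompatible (s : Fin M → Fin 4 → Bit) (κ : Fin M → Option Bool) (run : Fin N → Fin M)
    (lab : Fin N → Label) (t : Fin M) (x : Coins) : Prop :=
  runKind x (s t) = κ t ∧ ∀ v, run v = t → preparedLabel x.1 x.2.1 = lab v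

open Classical in
/-- A run, averaged over the compatible coins. -/
noncomputable def PrepStrategy.labelledRun (S : PrepStrategy l B)
    (dec : Bit → (Fin l → Bit) → Bit) (p p' : ℝ) (s : Fin M → Fin 4 → Bit)
    (κ : Fin M → Option Bool) (run : Fin N → Fin M) (lab : Fin N → Label) (t : Fin M) :
    Module.End ℂ (Matrix B B ℂ) :=
  weightedSum (fun x => if IsCompatible s κ run lab t x then (coinProb p p' x : ℂ) else 0)
    fun x => S.runLin dec t x (s t)

/-- Bob's unnormalised state when the runs have the kinds `κ` and the states on the vertices have the
names `lab`. -/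
noncomputable def PrepStrategy.labelledState (S : PrepStrategy l B)
    (dec : Bit → (Fin l → Bit) → Bit) (p p' : ℝ) (s : Fin M → Fin 4 → Bit)
    (κ : Fin M → Option Bool) (run : Fin N → Fin M) (lab : Fin N → Label) : Matrix B B ℂ :=
  seqComp M _ (S.labelledRun dec p p' s κ run lab) S.init

/-- Kinds and names are constrained run by run, so the indicator of the joint event is a product
over the runs. -/
theorem PrepStrategy.labelledState_eq_sum (S : PrepStrategy l B)
    (dec : Bit → (Fin l → Bit) → Bit) (p p' : ℝ) (s : Fin M → Fin 4 → Bit)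
    (κ : Fin M → Option Bool) (run : Fin N → Fin M) (lab : Fin N → Label) :
    S.labelledState dec p p' s κ run lab = ∑ x : Fin M → Coins,
      if (fun t => runKind (x t) (s t)) = κ ∧
          (fun v => preparedLabel (x (run v)).1 (x (run v)).2.1) = lab then
        ((∏ t, coinProb p p' (x t) : ℝ) : ℂ) • S.state dec x s else 0 := by
  classical
  unfold PrepStrategy.labelledState PrepStrategy.labelledRun weightedSum
  rw [← sum_prod_smul_seqComp, LinearMap.sum_apply]
  refine Finset.sum_congr rfl fun x _ => ?_
  rw [LinearMap.smul_apply, S.state_eq, Finset.prod_ite_zero]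
  have hiff : (∀ t ∈ Finset.univ, IsCompatible s κ run lab t (x t)) ↔
      (fun t => runKind (x t) (s t)) = κ ∧
        (fun v => preparedLabel (x (run v)).1 (x (run v)).2.1) = lab := by
    simp only [IsCompatible, funext_iff, forall_and, Finset.mem_univ, true_imp_iff]
    exact and_congr_right fun _ => ⟨fun h v => h _ v rfl, fun h t v hv => hv ▸ h v⟩
  simp only [hiff]
  split_ifs <;> simp

theorem PrepStrategy.labelledState_eq_zero (S : PrepStrategy l B)
    (dec : Bit → (Fin l → Bit) → Bit) (p p' : ℝ) (s : Fin M → Fin 4 → Bit)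
    (κ : Fin M → Option Bool) (run : Fin N → Fin M) (lab : Fin N → Label) (v : Fin N)
    (h : κ (run v) = some !(lab v).isLeft) : S.labelledState dec p p' s κ run lab = 0 := by
  rw [S.labelledState_eq_sum]
  refine Finset.sum_eq_zero fun x _ => if_neg ?_
  rintro ⟨rfl, rfl⟩
  simp only [runKind] at h
  split_ifs at h
  exact (Bool.eq_not_self _).1 (Option.some.inj h)

theorem PrepStrategy.weightedSum_pair_runLin (S : PrepStrategy l B)
    (dec : Bit → (Fin l → Bit) → Bit) (t : ℕ) (s : Fin 4 → Bit) {p : ℝ} (hp : p ≠ 1) (p' : ℝ)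
    (k : ZMod 8) :
    weightedSum (fun x : Coins => if preparedLabel x.1 x.2.1 = Sum.inr k ∨
        preparedLabel x.1 x.2.1 = Sum.inr (k + 4) then (coinProb p p' x : ℂ) else 0)
        (fun x => S.runLin dec t x s) =
      ((p ^ 2 * (1 - p') / 2 ^ 10 : ℝ) : ℂ) • S.runSum dec t s :=
  S.sum_pair_runLin dec t s hp p' k

theorem add_four_ne (k : ZMod 8) : k ≠ k + 4 := fun h =>
  absurd (left_eq_add.1 h) (by decide)

/-- By injectivity no other vertex constrains this run, and the name `|+_k⟩` already forces the kind
of a kept run. -/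
theorem isCompatible_update_self_iff {s : Fin M → Fin 4 → Bit} {κ : Fin M → Option Bool}
    {run : Fin N → Fin M} (hrun : Function.Injective run) (lab : Fin N → Label) {j : Fin N}
    (hj : κ (run j) = some false) (k : ZMod 8) (x : Coins) :
    IsCompatible s κ run (Function.update lab j (Sum.inr k)) (run j) x ↔
      s (run j) = 0 ∧ preparedLabel x.1 x.2.1 = Sum.inr k := by
  simp only [IsCompatible, hj, runKind]
  constructor
  · rintro ⟨h1, h2⟩
    refine ⟨?_, by simpa using h2 j rfl⟩
    by_contra h0
    simp [h0] at h1
  · rintro ⟨h1, h2⟩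
    refine ⟨by simp [h1, h2], fun v hv => ?_⟩
    rw [hrun hv, Function.update_self, h2]

theorem PrepStrategy.labelledRun_pair (S : PrepStrategy l B)
    (dec : Bit → (Fin l → Bit) → Bit) {p : ℝ} (hp : p ≠ 1) (p' : ℝ) (s : Fin M → Fin 4 → Bit)
    (κ : Fin M → Option Bool) {run : Fin N → Fin M} (hrun : Function.Injective run)
    (lab : Fin N → Label) (j : Fin N) (hj : κ (run j) = some false) (k : ZMod 8) :
    S.labelledRun dec p p' s κ run (Function.update lab j (Sum.inr k)) (run j) +
        S.labelledRun dec p p' s κ run (Function.update lab j (Sum.inr (k + 4))) (run j) =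
      if s (run j) = 0 then ((p ^ 2 * (1 - p') / 2 ^ 10 : ℝ) : ℂ) •
        S.runSum dec (run j) (s (run j)) else 0 := by
  have hc := isCompatible_update_self_iff (s := s) hrun lab hj
  by_cases hs : s (run j) = 0
  · rw [if_pos hs, ← S.weightedSum_pair_runLin dec (run j) (s (run j)) hp p' k]
    refine weightedSum_add (fun x => ?_) _
    simp only [hc, hs, true_and]
    by_cases h1 : preparedLabel x.1 x.2.1 = Sum.inr k
    · have h2 : preparedLabel x.1 x.2.1 ≠ Sum.inr (k + 4) := fun h =>
        add_four_ne k (Sum.inr.inj (h1.symm.trans h))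
      rw [if_pos h1, if_neg h2, if_pos (Or.inl h1), add_zero]
    · simp only [h1, if_false, zero_add, false_or]
  · have h0 : ∀ k, S.labelledRun dec p p' s κ run (Function.update lab j (Sum.inr k)) (run j) = 0 :=
      fun k => weightedSum_zero (fun x => if_neg fun h => hs ((hc k x).1 h).1) _
    rw [h0, h0, add_zero, if_neg hs]

theorem PrepStrategy.labelledRun_update (S : PrepStrategy l B)
    (dec : Bit → (Fin l → Bit) → Bit) (p p' : ℝ) (s : Fin M → Fin 4 → Bit)
    (κ : Fin M → Option Bool) (run : Fin N → Fin M) (lab : Fin N → Label) (j : Fin N) (L : Label) :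
    S.labelledRun dec p p' s κ run (Function.update lab j L) =
      Function.update (S.labelledRun dec p p' s κ run lab) (run j)
        (S.labelledRun dec p p' s κ run (Function.update lab j L) (run j)) := by
  classical
  ext1 t
  by_cases ht : t = run j
  · subst ht; simp
  · rw [Function.update_of_ne ht]
    have hc : ∀ x, IsCompatible s κ run (Function.update lab j L) t x ↔
        IsCompatible s κ run lab t x := by
      intro x
      refine and_congr_right fun _ => forall_congr' fun v => imp_congr_right fun hv => ?_
      rw [Function.update_of_ne]
      rintro rfl
      exact ht hv.symm
    simp only [PrepStrategy.labelledRun, hc]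

/-- Bob cannot distinguish the pairs `|+_k⟩`, `|+_{k+4}⟩`. -/
theorem PrepStrategy.labelledState_pair (S : PrepStrategy l B)
    (dec : Bit → (Fin l → Bit) → Bit) {p : ℝ} (hp : p ≠ 1) (p' : ℝ) (s : Fin M → Fin 4 → Bit)
    (κ : Fin M → Option Bool) {run : Fin N → Fin M} (hrun : Function.Injective run)
    (lab : Fin N → Label) (j : Fin N) (hj : κ (run j) = some false) (k : ZMod 8) :
    S.labelledState dec p p' s κ run (Function.update lab j (Sum.inr k)) +
        S.labelledState dec p p' s κ run (Function.update lab j (Sum.inr (k + 4))) =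
      seqComp M _ (Function.update (S.labelledRun dec p p' s κ run lab) (run j)
        (if s (run j) = 0 then ((p ^ 2 * (1 - p') / 2 ^ 10 : ℝ) : ℂ) •
          S.runSum dec (run j) (s (run j)) else 0)) S.init := by
  unfold PrepStrategy.labelledState
  -- The two compositions differ only in the slot `run j`, so multilinearity adds them there.
  rw [S.labelledRun_update dec p p' s κ run lab j (Sum.inr k),
    S.labelledRun_update dec p p' s κ run lab j (Sum.inr (k + 4)), ← LinearMap.add_apply,
    ← MultilinearMap.map_update_add, S.labelledRun_pair dec hp p' s κ hrun lab j hj k]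

end Labelled

/-! ### The messages of the Fitzsimons–Kashefi protocol -/

theorem sum_eq_sum_of_sum_update_eq {ι Z V : Type} [Fintype ι] [DecidableEq ι] [Fintype Z]
    [AddCommMonoid V] (j : ι) (g g' : (ι → Z) → V)
    (h : ∀ a, ∑ z, g (Function.update a j z) = ∑ z, g' (Function.update a j z)) :
    ∑ a, g a = ∑ a, g' a := by
  rcases isEmpty_or_nonempty Z with hZ | ⟨⟨z0⟩⟩
  · have : IsEmpty (ι → Z) := ⟨fun a => hZ.false (a j)⟩
    simp
  rw [← (Equiv.funSplitAt j Z).symm.sum_comp g, ← (Equiv.funSplitAt j Z).symm.sum_comp g',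
    Fintype.sum_prod_type_right, Fintype.sum_prod_type_right]
  refine Finset.sum_congr rfl fun rest _ => ?_
  have hz : ∀ z, (Equiv.funSplitAt j Z).symm (z, rest) =
      Function.update ((Equiv.funSplitAt j Z).symm (z0, rest)) j z := by
    intro z
    ext i
    by_cases hi : i = j
    · subst hi; simp
    · simp [hi]
  have hsum : ∀ g : (ι → Z) → V, ∑ z, g ((Equiv.funSplitAt j Z).symm (z, rest)) =
      ∑ z, g (Function.update ((Equiv.funSplitAt j Z).symm (z0, rest)) j z) := fun g =>
    Finset.sum_congr rfl fun z _ => congrArg g (hz z)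
  rw [hsum g, hsum g', h]

/-- The one-time pad: a shift of a uniform angle is invisible. -/
theorem sum_shift_eq {V : Type} [AddCommGroup V] [Module ℂ V] (K : ZMod 8 → Module.End ℂ V)
    (f : ZMod 8 → V) (hf : ∀ k, f k + f (k + 4) = f 0 + f 4) (θ : ZMod 8) :
    ∑ k, ∑ r : Bit, K (k + θ + 4 * bitToOct r) (f k) = ∑ e, K e (f 0 + f 4) := by
  have h : ∀ r : Bit, ∑ k, K (k + θ + 4 * bitToOct r) (f k) =
      ∑ e, K e (f (e - (θ + 4 * bitToOct r))) := by
    intro r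
    rw [← Equiv.sum_comp (Equiv.addRight (θ + 4 * bitToOct r))
      fun e => K e (f (e - (θ + 4 * bitToOct r)))]
    simp [add_assoc]
  rw [Finset.sum_comm]
  simp only [h, sum_bit]
  rw [← Finset.sum_add_distrib]
  refine Finset.sum_congr rfl fun e _ => ?_
  rw [← map_add, ← hf (e - θ)]
  congr 3
  · simp [bitToOct]
  -- Modulo eight `-4 = 4`: the two values of `r` select the two members of one pair.
  · have h4 : ∀ e θ : ZMod 8, e - (θ + 4 * bitToOct 1) = e - θ + 4 := by decide
    exact h4 e θ

section Messages

variable {N : ℕ}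

open Classical in
/-- The messages, for arbitrary angles `φ`. -/
noncomputable def deltaOf (G : SimpleGraph (Fin N)) (φ : Fin N → (Fin N → FKCoins) → ZMod 8)
    (lab : Fin N → Label) (y : Fin N → FKCoins) (v : Fin N) : ZMod 8 :=
  Sum.elim (fun _ => (y v).2.1) id (lab v) + φ v y + 4 * bitToOct (y v).1 +
    4 * ((Finset.univ.filter fun u => G.Adj v u ∧ lab u = Sum.inl 1).card : ZMod 8)

open Classical in
/-- The angles of a delegation, for given replies of Bob. -/
noncomputable def Delegation.angles {D : Finset (Fin N)} (A : Delegation N D) (b : Fin N → Bit)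
    (v : Fin N) (y : Fin N → FKCoins) : ZMod 8 :=
  if v ∈ D then (y v).2.2
  else if v ∈ A.trap then 0
  else A.angle v fun j => b (Fin.castLE v.isLt.le j) + (y (Fin.castLE v.isLt.le j)).1

theorem delta_eq_deltaOf {D : Finset (Fin N)} (G : SimpleGraph (Fin N)) (A : Delegation N D)
    (lab : Fin N → Label) (y : Fin N → FKCoins) (b : Fin N → Bit) :
    delta G A lab y b = deltaOf G (A.angles b) lab y := by
  ext1 v
  unfold delta deltaOf Delegation.angles
  cases lab v <;> rfl

-- The pad at `j` reaches only the message of `j`: a state `|+_k⟩` never counts as a neighbour in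
-- `|1⟩`, and by `hφ` no angle uses the coins of `j`.
open Classical in
theorem deltaOf_update (G : SimpleGraph (Fin N)) (φ φ' : Fin N → (Fin N → FKCoins) → ZMod 8)
    (j : Fin N) (hφ : ∀ v y w, φ v (Function.update y j w) = φ v y)
    (hφφ' : ∀ v, v ≠ j → φ v = φ' v)
    (lab : Fin N → Label) (y : Fin N → FKCoins) (k : ZMod 8) (w : FKCoins) :
    deltaOf G φ (Function.update lab j (Sum.inr k)) (Function.update y j w) =
      Function.update (deltaOf G φ' (Function.update lab j (Sum.inr 0)) y) j
        (k + (φ j y + 4 * ((Finset.univ.filter fun u => G.Adj j u ∧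
          Function.update lab j (Sum.inr 0) u = Sum.inl 1).card : ZMod 8)) + 4 * bitToOct w.1) := by
  have hones : ∀ v : Fin N, (Finset.univ.filter fun u => G.Adj v u ∧
      Function.update lab j (Sum.inr k) u = Sum.inl 1) = Finset.univ.filter fun u => G.Adj v u ∧
      Function.update lab j (Sum.inr 0) u = Sum.inl 1 := by
    intro v
    ext u
    by_cases hu : u = j
    · subst hu; simp
    · simp [hu]
  ext1 v
  unfold deltaOf
  rw [hφ, hones]
  by_cases hv : v = j
  · subst hv
    simp only [Function.update_self, Sum.elim_inr, id]
    ring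
  · simp [hv, hφφ' v hv]

variable {V : Type} [AddCommGroup V] [Module ℂ V]

/-- With everything away from `j` fixed, the angle and the neighbour count at `j` form a constant
shift `θ`, which `sum_shift_eq` removes. -/
theorem sum_deltaOf_eq (G : SimpleGraph (Fin N)) (φ φ' : Fin N → (Fin N → FKCoins) → ZMod 8)
    (j : Fin N) (hφ : ∀ v y w, φ v (Function.update y j w) = φ v y)
    (hφ' : ∀ v y w, φ' v (Function.update y j w) = φ' v y)
    (hφφ' : ∀ v, v ≠ j → φ v = φ' v) (H : (Fin N → ZMod 8) → Module.End ℂ V)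
    (f : (Fin N → Label) → V)
    (hf0 : ∀ lab z, f (Function.update lab j (Sum.inl z)) = 0)
    (hf : ∀ lab k, f (Function.update lab j (Sum.inr k)) +
      f (Function.update lab j (Sum.inr (k + 4))) =
      f (Function.update lab j (Sum.inr 0)) + f (Function.update lab j (Sum.inr 4))) :
    ∑ y, ∑ lab, H (deltaOf G φ lab y) (f lab) = ∑ y, ∑ lab, H (deltaOf G φ' lab y) (f lab) := by
  have hpair : ∀ φ : Fin N → (Fin N → FKCoins) → ZMod 8,
      ∑ y, ∑ lab, H (deltaOf G φ lab y) (f lab) =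
      ∑ a : Fin N → FKCoins × Label,
        H (deltaOf G φ (fun v => (a v).2) fun v => (a v).1) (f fun v => (a v).2) := by
    intro φ
    rw [← Fintype.sum_prod_type']
    exact (Fintype.sum_equiv (Equiv.arrowProdEquivProdArrow _ _ _) _ _ fun _ => rfl).symm
  rw [hpair, hpair]
  refine sum_eq_sum_of_sum_update_eq j _ _ fun a => ?_
  have h1 : ∀ z, (fun v => (Function.update a j z v).1) =
      Function.update (fun v => (a v).1) j z.1 := fun z => by
    ext1 v; by_cases hv : v = j
    · subst hv; simp
    · simp [hv]
  have h2 : ∀ z, (fun v => (Function.update a j z v).2) =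
      Function.update (fun v => (a v).2) j z.2 := fun z => by
    ext1 v; by_cases hv : v = j
    · subst hv; simp
    · simp [hv]
  simp only [h1, h2]
  generalize (fun v => (a v).1) = y
  generalize (fun v => (a v).2) = lab
  -- The `Z`-basis names, which `hf0` kills, are split off; among the rest `(k, r)` is the pad and
  -- `u` are the spare dummy coins.
  have hz : ∀ g : FKCoins × Label → V, ∑ z, g z =
      ∑ z, ∑ w, g (w, Sum.inl z) + ∑ u, ∑ k, ∑ r, g ((r, u), Sum.inr k) := by
    intro g
    rw [Fintype.sum_prod_type_right, Fintype.sum_sum_type]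
    congr 1
    refine Eq.trans ?_ Finset.sum_comm
    exact Finset.sum_congr rfl fun k _ => Fintype.sum_prod_type_right _
  simp only [hz, hf0, map_zero, Finset.sum_const_zero, zero_add,
    deltaOf_update G φ φ' j hφ hφφ', deltaOf_update G φ' φ' j hφ' fun _ _ => rfl]
  refine Finset.sum_congr rfl fun u _ => ?_
  rw [sum_shift_eq (fun e => H (Function.update _ j e))
      (fun k => f (Function.update lab j (Sum.inr k))) (hf lab),
    sum_shift_eq (fun e => H (Function.update _ j e))
      (fun k => f (Function.update lab j (Sum.inr k))) (hf lab)]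

/-- The angles are hidden: Bob's averaged state does not depend on them. -/
theorem sum_delta_eq {D : Finset (Fin N)} (G : SimpleGraph (Fin N)) (A A' : Delegation N D)
    (b : Fin N → Bit) (H : (Fin N → ZMod 8) → Module.End ℂ V) (f : (Fin N → Label) → V)
    (hf0 : ∀ j, j ∉ D → ∀ lab z, f (Function.update lab j (Sum.inl z)) = 0)
    (hf : ∀ j, j ∉ D → ∀ lab k, f (Function.update lab j (Sum.inr k)) +
      f (Function.update lab j (Sum.inr (k + 4))) =
      f (Function.update lab j (Sum.inr 0)) + f (Function.update lab j (Sum.inr 4))) :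
    ∑ y, ∑ lab, H (delta G A lab y b) (f lab) = ∑ y, ∑ lab, H (delta G A' lab y b) (f lab) := by
  classical
  -- Hybrids: the true angles before vertex `n` and at dummies, zero elsewhere. Passing from `n + 1`
  -- to `n` erases the angle of vertex `n` when the later angles that could use its bit `r'` are
  -- already gone.
  let φ : Delegation N D → ℕ → Fin N → (Fin N → FKCoins) → ZMod 8 := fun A n v y =>
    if v.val < n ∨ v ∈ D then A.angles b v y else 0
  have hstep : ∀ A : Delegation N D, ∀ n ≤ N,
      ∑ y, ∑ lab, H (deltaOf G (φ A n) lab y) (f lab) =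
        ∑ y, ∑ lab, H (deltaOf G (φ A 0) lab y) (f lab) := by
    intro A n
    induction n with
    | zero => exact fun _ => rfl
    | succ n ih =>
      intro hn
      rw [← ih (by omega)]
      let j : Fin N := ⟨n, hn⟩
      have hne : ∀ v, v ≠ j → φ A (n + 1) v = φ A n v := by
        intro v hv
        have hv' : v.val ≠ n := fun h => hv (Fin.ext h)
        have : v.val < n + 1 ↔ v.val < n := by omega
        simp only [φ, this]
      by_cases hj : j ∈ D
      · have : φ A (n + 1) = φ A n := by
          ext1 v
          by_cases hv : v = j
          · subst hv; simp only [φ, hj, or_true, if_true]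
          · exact hne v hv
        rw [this]
      · have hdep : ∀ m ≤ n + 1, ∀ v y w, φ A m v (Function.update y j w) = φ A m v y := by
          intro m hm v y w
          by_cases hvD : v ∈ D
          · have hvj : v ≠ j := by rintro rfl; exact hj hvD
            simp [φ, hvD, Delegation.angles, hvj]
          · by_cases hvm : v.val < m
            · have hu : ∀ u : Fin v.val, Fin.castLE v.isLt.le u ≠ j := by
                intro u hu
                have := congrArg Fin.val hu
                have hu' := u.isLt
                simp only [Fin.val_castLE, j] at this
                omega
              simp [φ, hvD, Delegation.angles, hu]
            · simp [φ, hvD, hvm]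
        exact sum_deltaOf_eq G _ _ j (hdep _ le_rfl) (hdep n (by omega)) hne H f (hf0 j hj) (hf j hj)
  have hN : ∀ A : Delegation N D, φ A N = A.angles b := fun A => by
    ext v y; simp [φ]
  -- Only the dummy angles survive, and these are Alice's own coins rather than part of the
  -- delegation.
  have h0 : φ A 0 = φ A' 0 := by
    ext v y
    by_cases hv : v ∈ D <;> simp [φ, hv, Delegation.angles]
  simp only [delta_eq_deltaOf]
  rw [← hN A, ← hN A', hstep A N le_rfl, hstep A' N le_rfl, h0]

end Messages

/-! ### The whole protocol -/

section Protocol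

variable {l M N : ℕ} {B : Type} [Fintype B] [DecidableEq B]

/-- Bob's operations after the runs of the gadget, for given messages and replies. -/
noncomputable def FKStrategy.replies (F : FKStrategy N B) (run : Fin N → ℕ) (b : Fin N → Bit)
    (d : Fin N → ZMod 8) : Module.End ℂ (Matrix B B ℂ) :=
  (seqComp N _ fun v => (F.reply v (d v)).lin (b v)) * (F.start run).lin ()

theorem FKStrategy.replies_apply (F : FKStrategy N B) (run : Fin N → ℕ) (b : Fin N → Bit)
    (d : Fin N → ZMod 8) (σ : Matrix B B ℂ) :
    F.replies run b d σ =
      Fin.foldl N (fun σ v => (F.reply v (d v)).apply (b v) σ) ((F.start run).map σ) := by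
  rw [FKStrategy.replies, Module.End.mul_apply, ← foldl_eq_seqComp]
  rfl

theorem PrepStrategy.sum_state_eq_sum_labelledState (S : PrepStrategy l B)
    (dec : Bit → (Fin l → Bit) → Bit) (p p' : ℝ) (s : Fin M → Fin 4 → Bit)
    (κ : Fin M → Option Bool) (run : Fin N → Fin M)
    (K : (Fin N → Label) → Module.End ℂ (Matrix B B ℂ)) :
    ∑ x : Fin M → Coins, (if (fun t => runKind (x t) (s t)) = κ then
      ((∏ t, coinProb p p' (x t) : ℝ) : ℂ) •
        K (fun v => preparedLabel (x (run v)).1 (x (run v)).2.1) (S.state dec x s) else 0) =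
      ∑ lab, K lab (S.labelledState dec p p' s κ run lab) := by
  simp only [S.labelledState_eq_sum, map_sum]
  rw [Finset.sum_comm]
  refine Finset.sum_congr rfl fun x _ => ?_
  rw [Finset.sum_eq_single fun v => preparedLabel (x (run v)).1 (x (run v)).2.1]
  · simp only [and_true, apply_ite (K _), map_zero, map_smul]
  · intro lab _ h
    rw [if_neg fun h' => h h'.2.symm, map_zero]
  · simp

-- The coins are sorted by `κ`, which fixes both the stopping event and the assignment, and then by
-- the names on the vertices, the only other data that the messages use.
open Classical in
theorem finalState_eq (S : PrepStrategy l B) (F : FKStrategy N B)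
    (dec : Bit → (Fin l → Bit) → Bit) (p p' : ℝ) (G : SimpleGraph (Fin N)) {D : Finset (Fin N)}
    (assign : (Fin M → Option Bool) → Fin N → Fin M) (A : Delegation N D) :
    finalState S F dec p p' G assign A =
      ∑ s : Fin M → Fin 4 → Bit, ∑ κ, if FinishesAt N D.card κ then
        ((1 : ℂ) / (2 * 8 * 8) ^ N) • ∑ b, ∑ y, ∑ lab,
          F.replies (fun v => (assign κ v : ℕ)) b (delta G A lab y b)
            (S.labelledState dec p p' s κ (assign κ) lab)
      else 0 := by
  unfold finalState
  rw [Finset.sum_comm]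
  refine Finset.sum_congr rfl fun s _ => ?_
  simp only [← F.replies_apply]
  calc _ = ∑ κ, ∑ x : Fin M → Coins, if FinishesAt N D.card κ then
          if (fun t => runKind (x t) (s t)) = κ then ((∏ t, coinProb p p' (x t) : ℝ) : ℂ) •
            ∑ y : Fin N → FKCoins, ((1 : ℂ) / (2 * 8 * 8) ^ N) • ∑ b : Fin N → Bit,
              F.replies (fun v => (assign κ v : ℕ)) b (delta G A
                (fun v => preparedLabel (x (assign κ v)).1 (x (assign κ v)).2.1) y b)
                (S.state dec x s)
          else 0 else 0 := by
        rw [Finset.sum_comm]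
        refine Finset.sum_congr rfl fun x _ => ?_
        rw [Finset.sum_eq_single fun t => runKind (x t) (s t)]
        · simp
        · intro κ _ h
          rw [if_neg h.symm, ite_self]
        · simp
    _ = _ := by
        refine Finset.sum_congr rfl fun κ _ => ?_
        split_ifs with hκ
        · simp only [← S.sum_state_eq_sum_labelledState dec p p' s κ (assign κ)]
          rw [Finset.sum_congr rfl fun b _ => Finset.sum_comm, Finset.sum_comm, Finset.smul_sum]
          refine Finset.sum_congr rfl fun x _ => ?_
          split_ifs
          · rw [← Finset.smul_sum, Finset.sum_comm, smul_comm]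
            simp only [← Finset.smul_sum]
          · simp
        · simp

theorem finalState_eq_finalState (S : PrepStrategy l B) (F : FKStrategy N B)
    (dec : Bit → (Fin l → Bit) → Bit) {p : ℝ} (hp : p ≠ 1) (p' : ℝ) (G : SimpleGraph (Fin N))
    {D : Finset (Fin N)} {assign : (Fin M → Option Bool) → Fin N → Fin M}
    (hassign : IsAssignment D assign) (A A' : Delegation N D) :
    finalState S F dec p p' G assign A = finalState S F dec p p' G assign A' := by
  classical
  simp only [finalState_eq]
  refine Finset.sum_congr rfl fun s _ => Finset.sum_congr rfl fun κ _ => ?_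
  split_ifs with hκ
  · obtain ⟨hinj, hkind⟩ := hassign κ hκ
    refine congrArg _ (Finset.sum_congr rfl fun b _ => ?_)
    refine sum_delta_eq G A A' b (F.replies (fun v => (assign κ v : ℕ)) b)
      (S.labelledState dec p p' s κ (assign κ)) (fun j hj lab z => ?_) fun j hj lab k => ?_
    · refine S.labelledState_eq_zero dec p p' s κ _ _ j ?_
      simp [hkind, hj]
    · have hj' : κ (assign κ j) = some false := by simp [hkind, hj]
      -- The formula for the sum over a pair does not mention `k`, so every pair is compared with
      -- `{0, 4}`.
      have h0 := S.labelledState_pair dec hp p' s κ hinj lab j hj' 0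
      rw [zero_add] at h0
      rw [h0, S.labelledState_pair dec hp p' s κ hinj lab j hj' k]
  · rfl

end Protocol

theorem theorem3 {l : ℕ} (code : CSSCode l) (dec : Bit → (Fin l → Bit) → Bit)
    (hdec : ∀ c, code.IsDecoder (dec c))
    {B : Type} [Fintype B] [DecidableEq B] (S : PrepStrategy l B) :
    (∀ (M : ℕ) (s : Fin M → Fin 4 → Bit), ∃ E : Channel (Kept s → Bit) B,
      ∀ (N ND : ℕ) (p p' : ℝ), 0 < p → p < 1 / 2 → 0 < p' → p' < 1 →
        (ND : ℝ) / N = 1 - 4 * p ^ 2 * (1 - p') →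
        (S.jointState dec p p' s).trace ≠ 0 →
        ∀ Q : Matrix B B ℂ, IsPOVMElement Q →
          bobProb Q (S.output dec p p' s) = bobProb Q (fkState ((ND : ℝ) / N) E)) ∧
    (∀ (N : ℕ) (F : FKStrategy N B) (p p' : ℝ), 0 < p → p < 1 / 2 → 0 < p' → p' < 1 →
      ∀ (G : SimpleGraph (Fin N)) (D : Finset (Fin N)),
        (D.card : ℝ) / N = 1 - 4 * p ^ 2 * (1 - p') →
        ∀ (M : ℕ) (assign : (Fin M → Option Bool) → Fin N → Fin M), IsAssignment D assign →
          ∀ A A' : Delegation N D, ∀ Q : Matrix B B ℂ, IsPOVMElement Q →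
            (Q * finalState S F dec p p' G assign A).trace =
              (Q * finalState S F dec p p' G assign A').trace) := by
  refine ⟨fun M s => ?_, fun N F p p' _ hp _ _ G D _ M assign hassign A A' Q _ => ?_⟩
  · obtain ⟨E, hE⟩ := S.exists_channel dec s
    exact ⟨E, fun N ND p p' _ _ _ _ _ htr Q _ => hE p p' _ htr Q⟩
  · rw [finalState_eq_finalState S F dec (by linarith) p' G hassign A A']
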